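/- For $n\ge 1$ let $\mathbb B^n=\{x\in\mathbb R^n : |x|<1\}$ be the open unit ball with the Euclidean metric. A smooth ($C^\infty$) foliation of codimension $q$ on an open set $M\subseteq\mathbb R^{p+q}$ is a decomposition of $M$ into a disjoint union of injectively immersed connected smooth $p$-dimensional submanifolds, called leaves, such that each point of $M$ has an open neighbourhood $U$ and a smooth diffeomorphism from $U$ onto $\mathbb R^p\times\mathbb R^q$ which carries the restriction of the foliation to $U$ (whose leaves are the connected components, in the leaf topology, of the intersections of the leaves with $U$) to the family of parallel planes $\{\mathbb R^p\times\{y\}\}_{y\in\mathbb R^q}$. The foliation is closed if every leaf is a closed subset of $M$, and complete if every leaf is complete with respect to the Riemannian metric induced from the Euclidean metric. **Proposition 6.1.** Let $p\ge 0$ be an integer and let $q,q'$ be integers with $1\le q<q'$. Let $L$ be a connected smooth $p$-dimensional manifold. If there is a complete closed smooth foliation of codimension $q$ on $\mathbb B^{p+q}$ with a leaf diffeomorphic to $L$, then there is a complete closed smooth foliation of codimension $q'$ on $\mathbb B^{p+q'}$ with a leaf diffeomorphic to $L$. -/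

import Mathlib

open Set Filter Topology
open scoped Manifold ContDiff ENNReal

/-- A smooth foliation with `p`-dimensional leaves and codimension `q` on an open subset `M` of
`ℝ^(p+q)`: a decomposition of `M` into disjoint injectively immersed connected smooth
`p`-manifolds (the leaves) which is locally smoothly equivalent to the family
`{ℝ^p × {y}}`, `y ∈ ℝ^q`, of parallel planes.  Each leaf carries its own manifold topology, which
may be finer than the topology induced from `M`.
(`M` is automatically open, being covered by the domains of foliated charts.) -/
structure Foliation (p q : ℕ) (M : Set (EuclideanSpace ℝ (Fin (p + q)))) where
  /-- The set of indices of the leaves. -/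
  ι : Type
  /-- The leaves, as abstract manifolds. -/
  Leaf : ι → Type
  [topology : ∀ i, TopologicalSpace (Leaf i)]
  [charted : ∀ i, ChartedSpace (EuclideanSpace ℝ (Fin p)) (Leaf i)]
  [manifold : ∀ i, IsManifold (𝓡 p) ∞ (Leaf i)]
  [connected : ∀ i, ConnectedSpace (Leaf i)]
  /-- The inclusion of a leaf in the ambient Euclidean space. -/
  incl : ∀ i, Leaf i → EuclideanSpace ℝ (Fin (p + q))
  incl_smooth : ∀ i, ContMDiff (𝓡 p) (𝓡 (p + q)) ∞ (incl i)
  incl_immersion : ∀ i a, Function.Injective (mfderiv (𝓡 p) (𝓡 (p + q)) (incl i) a)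
  incl_injective : ∀ i, Function.Injective (incl i)
  /-- Different leaves are disjoint. -/
  disjoint : ∀ i j, i ≠ j → Disjoint (range (incl i)) (range (incl j))
  /-- The union of the leaves is `M`. -/
  iUnion_range : ⋃ i, range (incl i) = M
  /-- Local triviality: every point of `M` has an open neighbourhood `U = φ.source ⊆ M` with a
  smooth diffeomorphism `φ` from `U` onto `ℝ^p × ℝ^q` which maps the leaves of the restriction of
  the foliation to `U`, i.e. the connected components (in the leaf topology) of the intersections
  of the leaves with `U`, onto the planes `ℝ^p × {y}`. -/
  locally_trivial : ∀ x ∈ M,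
    ∃ φ : OpenPartialHomeomorph (EuclideanSpace ℝ (Fin (p + q)))
        (EuclideanSpace ℝ (Fin p) × EuclideanSpace ℝ (Fin q)),
      x ∈ φ.source ∧ φ.source ⊆ M ∧ φ.target = univ ∧
      ContDiffOn ℝ ∞ φ φ.source ∧ ContDiffOn ℝ ∞ φ.symm φ.target ∧
      ∀ i, ∀ a ∈ incl i ⁻¹' φ.source,
        (fun b ↦ φ (incl i b)) '' connectedComponentIn (incl i ⁻¹' φ.source) a =
          {z | z.2 = (φ (incl i a)).2}

attribute [instance] Foliation.topology Foliation.charted Foliation.manifold Foliation.connected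

/-- The norm on the tangent spaces of `N` given by the Riemannian metric induced from `ℝ^n` by an
immersion `f : N → ℝ^n`: the length of a tangent vector `v` is the Euclidean length of `df(v)`. -/
noncomputable abbrev inducedENorm (p : ℕ) {n : ℕ} {N : Type*} [TopologicalSpace N]
    [ChartedSpace (EuclideanSpace ℝ (Fin p)) N] (f : N → EuclideanSpace ℝ (Fin n)) (x : N) :
    ENorm (TangentSpace (𝓡 p) x) where
  enorm v := enorm (E := EuclideanSpace ℝ (Fin n)) (mfderiv (𝓡 p) (𝓡 n) f x v)

/-- The Riemannian distance on `N` of the Riemannian metric induced from `ℝ^n` by an immersion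
`f : N → ℝ^n`: the infimum of the lengths of the `C^1` paths in `N` joining two points. -/
noncomputable def inducedEDist (p : ℕ) {n : ℕ} {N : Type*} [TopologicalSpace N]
    [ChartedSpace (EuclideanSpace ℝ (Fin p)) N] (f : N → EuclideanSpace ℝ (Fin n)) (x y : N) :
    ℝ≥0∞ :=
  letI : ∀ z : N, ENorm (TangentSpace (𝓡 p) z) := inducedENorm p f
  Manifold.riemannianEDist (𝓡 p) x y

/-- `N` is complete for the Riemannian metric induced by `f`: every sequence which is Cauchy for
the Riemannian distance converges for it. -/
def IsCompleteImmersed (p : ℕ) {n : ℕ} {N : Type*} [TopologicalSpace N]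
    [ChartedSpace (EuclideanSpace ℝ (Fin p)) N] (f : N → EuclideanSpace ℝ (Fin n)) : Prop :=
  ∀ u : ℕ → N,
    (∀ ε : ℝ≥0∞, 0 < ε → ∃ K, ∀ k ≥ K, ∀ l ≥ K, inducedEDist p f (u k) (u l) < ε) →
    ∃ a, Tendsto (fun k ↦ inducedEDist p f (u k) a) atTop (𝓝 0)

/-- A foliation of `M` is closed if all its leaves are closed subsets of `M`. -/
def Foliation.Closed {p q : ℕ} {M : Set (EuclideanSpace ℝ (Fin (p + q)))}
    (F : Foliation p q M) : Prop :=
  ∀ i, IsClosed {x : M | (x : EuclideanSpace ℝ (Fin (p + q))) ∈ range (F.incl i)}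

/-- A foliation of `M` is complete if all its leaves are complete for the Riemannian metric induced
from the Euclidean metric of `M`. -/
def Foliation.Complete {p q : ℕ} {M : Set (EuclideanSpace ℝ (Fin (p + q)))}
    (F : Foliation p q M) : Prop :=
  ∀ i, IsCompleteImmersed p (F.incl i)

/-- The foliation has a leaf diffeomorphic to `L`. -/
def Foliation.HasLeaf {p q : ℕ} {M : Set (EuclideanSpace ℝ (Fin (p + q)))}
    (F : Foliation p q M) (L : Type*) [TopologicalSpace L]
    [ChartedSpace (EuclideanSpace ℝ (Fin p)) L] : Prop :=
  ∃ i, Nonempty (F.Leaf i ≃ₘ^∞⟮𝓡 p, 𝓡 p⟯ L)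

/-! Put `d = q' - q` and cut the large ball by the affine subspaces parallel to a fixed
(p+q)-dimensional subspace. The slice at height `t` is a ball of radius `√(1 - ‖t‖²)`, so a
homothety carries the given foliation into it; the leaves in all slices together form the new
foliation. Each new leaf lies in a single slice, so its induced metric is the old one times a
constant (`norm_sliceLinear_apply`), which preserves completeness
(`inducedEDist_of_enorm_mfderiv_eq`). It is closed because the slice is closed in the ball and the
leaf is closed in the slice. The leaf manifolds themselves are unchanged. For local triviality,
`ballSlicing` straightens the large ball to a product of two balls, where the leaves become old
leaves times points. -/

section SliceRadius

variable {W : Type*} [SeminormedAddCommGroup W]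

lemma one_sub_norm_sq_pos {t : W} (ht : t ∈ Metric.ball (0 : W) 1) : 0 < 1 - ‖t‖ ^ 2 := by
  rw [mem_ball_zero_iff] at ht
  nlinarith [norm_nonneg t]

/-- The radius of the slice at height `t` of the unit ball. -/
noncomputable def sliceRadius (t : W) : ℝ := √(1 - ‖t‖ ^ 2)

lemma sliceRadius_pos {t : W} (ht : t ∈ Metric.ball (0 : W) 1) : 0 < sliceRadius t :=
  Real.sqrt_pos.2 (one_sub_norm_sq_pos ht)

lemma sliceRadius_sq {t : W} (ht : t ∈ Metric.ball (0 : W) 1) :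
    sliceRadius t ^ 2 = 1 - ‖t‖ ^ 2 :=
  Real.sq_sqrt (one_sub_norm_sq_pos ht).le

end SliceRadius

/-! ### Slicing the unit ball by parallel subspaces -/

section BallSlices

variable {V W X : Type*} [NormedAddCommGroup V] [InnerProductSpace ℝ V]
  [NormedAddCommGroup W] [InnerProductSpace ℝ W] [NormedAddCommGroup X] [InnerProductSpace ℝ X]

/-- The radicand vanishes on the unit sphere, where the square root is not smooth; on the open ball
it is positive. -/
lemma contDiffOn_sliceRadius :
    ContDiffOn ℝ ∞ (sliceRadius : W → ℝ) (Metric.ball 0 1) :=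
  ContDiffOn.sqrt (contDiff_const.sub (contDiff_norm_sq ℝ)).contDiffOn
    fun _ ht ↦ (one_sub_norm_sq_pos ht).ne'

/-- The embedding of `V` in `X` as the slice at height `t`, scaled so that the unit ball of `V`
is mapped onto the slice at height `t` of the unit ball of `X`. -/
noncomputable def sliceMap (A : X ≃ₗᵢ[ℝ] WithLp 2 (V × W)) (t : W) (v : V) : X :=
  A.symm (WithLp.toLp 2 (sliceRadius t • v, t))

lemma mem_ball_iff_norm_fst_lt (A : X ≃ₗᵢ[ℝ] WithLp 2 (V × W)) (x : X) :
    x ∈ Metric.ball (0 : X) 1 ↔ ‖(A x).fst‖ ^ 2 + ‖(A x).snd‖ ^ 2 < 1 := by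
  rw [mem_ball_zero_iff, ← A.norm_map x, ← WithLp.prod_norm_sq_eq_of_L2,
    sq_lt_one_iff₀ (norm_nonneg _)]

lemma snd_mem_ball (A : X ≃ₗᵢ[ℝ] WithLp 2 (V × W)) {x : X} (hx : x ∈ Metric.ball (0 : X) 1) :
    (A x).snd ∈ Metric.ball (0 : W) 1 := by
  rw [mem_ball_iff_norm_fst_lt A] at hx
  rw [mem_ball_zero_iff, ← sq_lt_one_iff₀ (norm_nonneg _)]
  nlinarith [sq_nonneg ‖(A x).fst‖]

lemma smul_fst_mem_ball (A : X ≃ₗᵢ[ℝ] WithLp 2 (V × W)) {x : X}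
    (hx : x ∈ Metric.ball (0 : X) 1) :
    (sliceRadius (A x).snd)⁻¹ • (A x).fst ∈ Metric.ball (0 : V) 1 := by
  have ht := snd_mem_ball A hx
  have hs := sliceRadius_pos ht
  rw [mem_ball_iff_norm_fst_lt A] at hx
  rw [mem_ball_zero_iff, norm_smul, norm_inv, Real.norm_of_nonneg hs.le, inv_mul_lt_one₀ hs]
  refine lt_of_pow_lt_pow_left₀ 2 hs.le ?_
  rw [sliceRadius_sq ht]
  linarith

lemma sliceMap_mem_ball (A : X ≃ₗᵢ[ℝ] WithLp 2 (V × W)) {t : W}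
    (ht : t ∈ Metric.ball (0 : W) 1) {v : V} (hv : v ∈ Metric.ball (0 : V) 1) :
    sliceMap A t v ∈ Metric.ball (0 : X) 1 := by
  have h := one_sub_norm_sq_pos ht
  have h' := one_sub_norm_sq_pos hv
  rw [mem_ball_iff_norm_fst_lt A]
  simp only [sliceMap, LinearIsometryEquiv.apply_symm_apply, WithLp.toLp_fst, WithLp.toLp_snd,
    norm_smul, mul_pow, Real.norm_eq_abs, sq_abs, sliceRadius_sq ht]
  -- One minus the squared norm of the image is exactly `(1 - ‖t‖²)(1 - ‖v‖²)`.
  nlinarith [mul_pos h h']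

/-- The unit ball as the product of the unit balls of complementary subspaces. -/
noncomputable def ballSlicing (A : X ≃ₗᵢ[ℝ] WithLp 2 (V × W)) :
    OpenPartialHomeomorph X (V × W) where
  toFun x := ((sliceRadius (A x).snd)⁻¹ • (A x).fst, (A x).snd)
  invFun z := sliceMap A z.2 z.1
  source := Metric.ball 0 1
  target := Metric.ball 0 1 ×ˢ Metric.ball 0 1
  map_source' _ hx := ⟨smul_fst_mem_ball A hx, snd_mem_ball A hx⟩
  map_target' _ hz := sliceMap_mem_ball A hz.2 hz.1
  left_inv' x hx := by
    simp only [sliceMap, smul_inv_smul₀ (sliceRadius_pos (snd_mem_ball A hx)).ne']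
    exact A.symm_apply_apply x
  right_inv' z hz := by
    simp [sliceMap, inv_smul_smul₀ (sliceRadius_pos hz.2).ne']
  open_source := Metric.isOpen_ball
  open_target := Metric.isOpen_ball.prod Metric.isOpen_ball
  continuousOn_toFun := by
    have h2 : Continuous fun x ↦ (A x).snd := by fun_prop
    have h1 : Continuous fun x ↦ (A x).fst := by fun_prop
    refine (ContinuousOn.smul (ContinuousOn.inv₀ ?_ ?_) h1.continuousOn).prodMk h2.continuousOn
    · exact contDiffOn_sliceRadius.continuousOn.comp h2.continuousOn fun x hx ↦ snd_mem_ball A hx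
    · exact fun x hx ↦ (sliceRadius_pos (snd_mem_ball A hx)).ne'
  continuousOn_invFun := by
    refine A.symm.continuous.comp_continuousOn ((WithLp.prod_continuous_toLp 2 V W).comp_continuousOn
      (ContinuousOn.prodMk (ContinuousOn.smul ?_ continuousOn_fst) continuousOn_snd))
    exact contDiffOn_sliceRadius.continuousOn.comp continuousOn_snd fun z hz ↦ hz.2

lemma contDiffOn_ballSlicing (A : X ≃ₗᵢ[ℝ] WithLp 2 (V × W)) :
    ContDiffOn ℝ ∞ (ballSlicing A) (Metric.ball 0 1) := by
  have h : ContDiff ℝ ∞ fun x ↦ WithLp.ofLp (A x) :=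
    ((WithLp.prodContinuousLinearEquiv 2 ℝ V W).contDiff).comp A.contDiff
  have h1 : ContDiff ℝ ∞ fun x ↦ (A x).fst := contDiff_fst.comp h
  have h2 : ContDiff ℝ ∞ fun x ↦ (A x).snd := contDiff_snd.comp h
  refine ContDiffOn.prodMk (ContDiffOn.smul (ContDiffOn.inv ?_ ?_) h1.contDiffOn) h2.contDiffOn
  · exact contDiffOn_sliceRadius.comp h2.contDiffOn fun x hx ↦ snd_mem_ball A hx
  · exact fun x hx ↦ (sliceRadius_pos (snd_mem_ball A hx)).ne'

lemma contDiffOn_ballSlicing_symm (A : X ≃ₗᵢ[ℝ] WithLp 2 (V × W)) :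
    ContDiffOn ℝ ∞ (ballSlicing A).symm (Metric.ball 0 1 ×ˢ Metric.ball 0 1) := by
  refine A.symm.contDiff.comp_contDiffOn
    ((WithLp.prodContinuousLinearEquiv 2 ℝ V W).symm.contDiff.comp_contDiffOn
      (ContDiffOn.prodMk (ContDiffOn.smul ?_ contDiffOn_fst) contDiffOn_snd))
  exact contDiffOn_sliceRadius.comp contDiffOn_snd fun z hz ↦ hz.2

lemma ballSlicing_sliceMap (A : X ≃ₗᵢ[ℝ] WithLp 2 (V × W)) {t : W}
    (ht : t ∈ Metric.ball (0 : W) 1) (v : V) : ballSlicing A (sliceMap A t v) = (v, t) := by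
  simp [ballSlicing, sliceMap, inv_smul_smul₀ (sliceRadius_pos ht).ne']

lemma sliceMap_ballSlicing (A : X ≃ₗᵢ[ℝ] WithLp 2 (V × W)) {x : X}
    (hx : x ∈ Metric.ball (0 : X) 1) :
    sliceMap A (ballSlicing A x).2 (ballSlicing A x).1 = x :=
  (ballSlicing A).left_inv hx

lemma sliceMap_injective (A : X ≃ₗᵢ[ℝ] WithLp 2 (V × W)) {t : W}
    (ht : t ∈ Metric.ball (0 : W) 1) : Function.Injective (sliceMap A t) := fun v w h ↦ by
  simpa [ballSlicing_sliceMap A ht] using congrArg (ballSlicing A) h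

/-- The linear part of `sliceMap`. -/
noncomputable def sliceLinear (A : X ≃ₗᵢ[ℝ] WithLp 2 (V × W)) (t : W) : V →L[ℝ] X :=
  sliceRadius t • ((A.symm : WithLp 2 (V × W) →L[ℝ] X) ∘L
    ((WithLp.prodContinuousLinearEquiv 2 ℝ V W).symm : V × W →L[ℝ] WithLp 2 (V × W)) ∘L
      ContinuousLinearMap.inl ℝ V W)

lemma sliceLinear_apply (A : X ≃ₗᵢ[ℝ] WithLp 2 (V × W)) (t : W) (v : V) :
    sliceLinear A t v = sliceRadius t • A.symm (WithLp.toLp 2 (v, 0)) := rfl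

lemma sliceMap_eq (A : X ≃ₗᵢ[ℝ] WithLp 2 (V × W)) (t : W) :
    sliceMap A t = fun v ↦ sliceLinear A t v + A.symm (WithLp.toLp 2 (0, t)) := by
  funext v
  rw [sliceLinear_apply, ← map_smul, ← map_add, sliceMap]
  simp [← WithLp.toLp_smul, ← WithLp.toLp_add]

lemma hasFDerivAt_sliceMap (A : X ≃ₗᵢ[ℝ] WithLp 2 (V × W)) (t : W) (v : V) :
    HasFDerivAt (sliceMap A t) (sliceLinear A t) v := by
  rw [sliceMap_eq]
  exact (sliceLinear A t).hasFDerivAt.add_const _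

lemma contDiff_sliceMap (A : X ≃ₗᵢ[ℝ] WithLp 2 (V × W)) (t : W) :
    ContDiff ℝ ∞ (sliceMap A t) := by
  rw [sliceMap_eq]
  exact (sliceLinear A t).contDiff.add contDiff_const

/-- The map is a homothety: its scale factor depends only on the slice, not on the point or the
direction. -/
lemma norm_sliceLinear_apply (A : X ≃ₗᵢ[ℝ] WithLp 2 (V × W)) {t : W}
    (ht : t ∈ Metric.ball (0 : W) 1) (v : V) :
    ‖sliceLinear A t v‖ = sliceRadius t * ‖v‖ := by
  rw [sliceLinear_apply, norm_smul, Real.norm_of_nonneg (sliceRadius_pos ht).le,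
    LinearIsometryEquiv.norm_map]
  simp

lemma enorm_sliceLinear_apply (A : X ≃ₗᵢ[ℝ] WithLp 2 (V × W)) {t : W}
    (ht : t ∈ Metric.ball (0 : W) 1) (v : V) :
    ‖sliceLinear A t v‖ₑ = ENNReal.ofReal (sliceRadius t) * ‖v‖ₑ := by
  rw [← ofReal_norm, norm_sliceLinear_apply A ht, ENNReal.ofReal_mul (sliceRadius_pos ht).le,
    ofReal_norm]

lemma sliceLinear_injective (A : X ≃ₗᵢ[ℝ] WithLp 2 (V × W)) {t : W}
    (ht : t ∈ Metric.ball (0 : W) 1) : Function.Injective (sliceLinear A t) := by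
  refine (injective_iff_map_eq_zero _).2 fun v hv ↦ ?_
  have h := norm_sliceLinear_apply A ht v
  rw [hv, norm_zero, zero_eq_mul] at h
  exact norm_eq_zero.1 (h.resolve_left (sliceRadius_pos ht).ne')

end BallSlices

/-! ### Induced metrics that differ by a constant factor -/

section Scaling

variable {p n m : ℕ} {N : Type*} [TopologicalSpace N] [ChartedSpace (EuclideanSpace ℝ (Fin p)) N]

/-- The same paths compete in both infima, and each length is multiplied by `c`. -/
lemma inducedEDist_of_enorm_mfderiv_eq {f : N → EuclideanSpace ℝ (Fin n)}
    {g : N → EuclideanSpace ℝ (Fin m)} {c : ℝ≥0∞} (hc : c ≠ 0) (hc' : c ≠ ⊤)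
    (h : ∀ x (v : TangentSpace (𝓡 p) x), (inducedENorm p g x).enorm v =
      c * (inducedENorm p f x).enorm v) (x y : N) :
    inducedEDist p g x y = c * inducedEDist p f x y := by
  simp only [inducedEDist, Manifold.riemannianEDist]
  simp_rw [ENNReal.mul_iInf_of_ne hc hc', ← MeasureTheory.lintegral_const_mul' c _ hc']
  refine iInf_congr fun γ ↦ iInf_congr fun _ ↦ ?_
  exact MeasureTheory.lintegral_congr fun s ↦ h _ _

lemma IsCompleteImmersed.of_inducedEDist_eq {f : N → EuclideanSpace ℝ (Fin n)}
    {g : N → EuclideanSpace ℝ (Fin m)} {c : ℝ≥0∞} (hc : c ≠ 0) (hc' : c ≠ ⊤)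
    (h : ∀ x y, inducedEDist p g x y = c * inducedEDist p f x y)
    (hf : IsCompleteImmersed p f) : IsCompleteImmersed p g := by
  intro u hu
  obtain ⟨a, ha⟩ := hf u fun ε hε ↦ by
    obtain ⟨K, hK⟩ := hu (c * ε) (ENNReal.mul_pos hc hε.ne')
    refine ⟨K, fun k hk l hl ↦ ?_⟩
    have := hK k hk l hl
    rwa [h, ENNReal.mul_lt_mul_iff_right hc hc'] at this
  refine ⟨a, ?_⟩
  simp_rw [h]
  simpa using ENNReal.Tendsto.const_mul ha (Or.inr hc')

end Scaling

/-! ### The sliced foliation and its charts -/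

namespace Foliation

variable {p q q' d : ℕ}

/-- The splitting of the leaf and transverse directions in a product of a foliated chart with
a Euclidean factor. -/
noncomputable def splitting (p : ℕ)
    (B : (EuclideanSpace ℝ (Fin q) × EuclideanSpace ℝ (Fin d)) ≃L[ℝ] EuclideanSpace ℝ (Fin q')) :
    ((EuclideanSpace ℝ (Fin p) × EuclideanSpace ℝ (Fin q)) × EuclideanSpace ℝ (Fin d)) ≃L[ℝ]
      EuclideanSpace ℝ (Fin p) × EuclideanSpace ℝ (Fin q') :=
  (ContinuousLinearEquiv.prodAssoc ℝ _ _ _).trans ((ContinuousLinearEquiv.refl ℝ _).prodCongr B)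

lemma splitting_apply
    (B : (EuclideanSpace ℝ (Fin q) × EuclideanSpace ℝ (Fin d)) ≃L[ℝ] EuclideanSpace ℝ (Fin q'))
    (z : (EuclideanSpace ℝ (Fin p) × EuclideanSpace ℝ (Fin q)) × EuclideanSpace ℝ (Fin d)) :
    splitting p B z = (z.1.1, B (z.1.2, z.2)) := rfl

/-- The chart of the unit ball induced on the slices by a chart of the lower-dimensional ball. -/
noncomputable def slicedChart
    (A : EuclideanSpace ℝ (Fin (p + q')) ≃ₗᵢ[ℝ]
      WithLp 2 (EuclideanSpace ℝ (Fin (p + q)) × EuclideanSpace ℝ (Fin d)))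
    (B : (EuclideanSpace ℝ (Fin q) × EuclideanSpace ℝ (Fin d)) ≃L[ℝ] EuclideanSpace ℝ (Fin q'))
    (φ : OpenPartialHomeomorph (EuclideanSpace ℝ (Fin (p + q)))
      (EuclideanSpace ℝ (Fin p) × EuclideanSpace ℝ (Fin q))) :
    OpenPartialHomeomorph (EuclideanSpace ℝ (Fin (p + q')))
      (EuclideanSpace ℝ (Fin p) × EuclideanSpace ℝ (Fin q')) :=
  ((ballSlicing A).trans (φ.prod OpenPartialHomeomorph.univUnitBall.symm)).trans
    (splitting p B).toHomeomorph.toOpenPartialHomeomorph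

section

variable (A : EuclideanSpace ℝ (Fin (p + q')) ≃ₗᵢ[ℝ]
      WithLp 2 (EuclideanSpace ℝ (Fin (p + q)) × EuclideanSpace ℝ (Fin d)))
    (B : (EuclideanSpace ℝ (Fin q) × EuclideanSpace ℝ (Fin d)) ≃L[ℝ] EuclideanSpace ℝ (Fin q'))
    (φ : OpenPartialHomeomorph (EuclideanSpace ℝ (Fin (p + q)))
      (EuclideanSpace ℝ (Fin p) × EuclideanSpace ℝ (Fin q)))

lemma slicedChart_apply (x : EuclideanSpace ℝ (Fin (p + q'))) :
    slicedChart A B φ x = splitting p B (φ (ballSlicing A x).1,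
      OpenPartialHomeomorph.univUnitBall.symm (ballSlicing A x).2) := rfl

lemma mem_slicedChart_source {x : EuclideanSpace ℝ (Fin (p + q'))} :
    x ∈ (slicedChart A B φ).source ↔
      x ∈ Metric.ball 0 1 ∧ (ballSlicing A x).1 ∈ φ.source := by
  have : x ∈ (slicedChart A B φ).source ↔ (x ∈ Metric.ball 0 1 ∧
      ((ballSlicing A x).1 ∈ φ.source ∧ (ballSlicing A x).2 ∈ Metric.ball 0 1)) ∧ True := Iff.rfl
  rw [this]
  exact ⟨fun h ↦ ⟨h.1.1, h.1.2.1⟩, fun h ↦ ⟨⟨h.1, h.2, snd_mem_ball A h.1⟩, trivial⟩⟩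

/-- The inverse of `univUnitBall` stretches the ball of heights onto all of Euclidean space, so no
transverse direction stays bounded. -/
lemma slicedChart_target (hφ : φ.source ⊆ Metric.ball 0 1) (hφ' : φ.target = univ) :
    (slicedChart A B φ).target = univ := by
  refine eq_univ_of_forall fun z ↦ ?_
  have h1 : φ.symm ((splitting p B).symm z).1 ∈ φ.source := φ.map_target (hφ' ▸ mem_univ _)
  have h2 := OpenPartialHomeomorph.univUnitBall.map_source
    (mem_univ ((splitting p B).symm z).2)
  exact ⟨trivial, ⟨hφ' ▸ mem_univ _, trivial⟩, hφ h1, h2⟩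

lemma contDiffOn_slicedChart (hφ : ContDiffOn ℝ ∞ φ φ.source) :
    ContDiffOn ℝ ∞ (slicedChart A B φ) (slicedChart A B φ).source := by
  have hs : (slicedChart A B φ).source ⊆ Metric.ball 0 1 :=
    fun x hx ↦ ((mem_slicedChart_source A B φ).1 hx).1
  have h := (contDiffOn_ballSlicing A).mono hs
  refine (splitting p B).contDiff.comp_contDiffOn (ContDiffOn.prodMk ?_ ?_)
  · exact hφ.comp (contDiff_fst.comp_contDiffOn h)
      fun x hx ↦ ((mem_slicedChart_source A B φ).1 hx).2
  · exact OpenPartialHomeomorph.contDiffOn_univUnitBall_symm.comp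
      (contDiff_snd.comp_contDiffOn h) fun x hx ↦ snd_mem_ball A (hs hx)

lemma contDiffOn_slicedChart_symm (hφ : φ.source ⊆ Metric.ball 0 1) (hφ' : φ.target = univ)
    (h : ContDiffOn ℝ ∞ φ.symm φ.target) :
    ContDiffOn ℝ ∞ (slicedChart A B φ).symm (slicedChart A B φ).target := by
  rw [slicedChart_target A B φ hφ hφ', contDiffOn_univ]
  rw [hφ', contDiffOn_univ] at h
  have h1 : ContDiff ℝ ∞ fun z ↦ φ.symm ((splitting p B).symm z).1 :=
    h.comp (contDiff_fst.comp (splitting p B).symm.contDiff)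
  have h2 : ContDiff ℝ ∞ fun z ↦
      OpenPartialHomeomorph.univUnitBall ((splitting p B).symm z).2 :=
    OpenPartialHomeomorph.contDiff_univUnitBall.comp
      (contDiff_snd.comp (splitting p B).symm.contDiff)
  refine (contDiffOn_ballSlicing_symm A).comp_contDiff (h1.prodMk h2) fun z ↦ ?_
  exact ⟨hφ (φ.map_target (hφ' ▸ mem_univ _)),
    OpenPartialHomeomorph.univUnitBall.map_source (mem_univ _)⟩

end

variable (F : Foliation p q (Metric.ball (0 : EuclideanSpace ℝ (Fin (p + q))) 1))
    (A : EuclideanSpace ℝ (Fin (p + q')) ≃ₗᵢ[ℝ]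
      WithLp 2 (EuclideanSpace ℝ (Fin (p + q)) × EuclideanSpace ℝ (Fin d)))
    (B : (EuclideanSpace ℝ (Fin q) × EuclideanSpace ℝ (Fin d)) ≃L[ℝ] EuclideanSpace ℝ (Fin q'))

lemma incl_mem_ball (i : F.ι) (a : F.Leaf i) : F.incl i a ∈ Metric.ball 0 1 := by
  have h : F.incl i a ∈ ⋃ j, range (F.incl j) := mem_iUnion_of_mem i (mem_range_self a)
  rwa [F.iUnion_range] at h

lemma mfderiv_sliceMap_comp_incl (t : EuclideanSpace ℝ (Fin d)) (i : F.ι) (a : F.Leaf i)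
    (v : TangentSpace (𝓡 p) a) :
    mfderiv (𝓡 p) (𝓡 (p + q')) (fun b ↦ sliceMap A t (F.incl i b)) a v =
      sliceLinear A t (mfderiv (𝓡 p) (𝓡 (p + q)) (F.incl i) a v) := by
  have h1 : HasMFDerivAt (𝓡 p) (𝓡 (p + q)) (F.incl i) a _ :=
    ((F.incl_smooth i).mdifferentiable (by simp) a).hasMFDerivAt
  have h2 : HasMFDerivAt (𝓡 (p + q)) (𝓡 (p + q')) (sliceMap A t) (F.incl i a) (sliceLinear A t) :=
    (hasFDerivAt_sliceMap A t (F.incl i a)).hasMFDerivAt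
  have h3 := (h2.comp a h1).mfderiv
  exact DFunLike.congr_fun h3 v

/-- The foliation of the unit ball whose leaves are, in each slice parallel to a subspace, the
rescaled leaves of a foliation of the unit ball of this subspace. -/
noncomputable def sliced :
    Foliation p q' (Metric.ball (0 : EuclideanSpace ℝ (Fin (p + q'))) 1) where
  ι := F.ι × Metric.ball (0 : EuclideanSpace ℝ (Fin d)) 1
  Leaf i := F.Leaf i.1
  topology i := F.topology i.1
  charted i := F.charted i.1
  manifold i := F.manifold i.1
  connected i := F.connected i.1
  incl i a := sliceMap A i.2 (F.incl i.1 a)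
  incl_smooth i := (contDiff_sliceMap A i.2).contMDiff.comp (F.incl_smooth i.1)
  incl_immersion i a := by
    intro v w hvw
    rw [mfderiv_sliceMap_comp_incl, mfderiv_sliceMap_comp_incl] at hvw
    exact F.incl_immersion i.1 a (sliceLinear_injective A i.2.2 hvw)
  incl_injective i := (sliceMap_injective A i.2.2).comp (F.incl_injective i.1)
  disjoint := by
    rintro ⟨i, t⟩ ⟨j, s⟩ hij
    refine disjoint_left.2 ?_
    rintro _ ⟨a, rfl⟩ ⟨b, hb⟩
    have h := congrArg (ballSlicing A) hb
    rw [ballSlicing_sliceMap A s.2, ballSlicing_sliceMap A t.2, Prod.mk.injEq] at h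
    obtain rfl : s = t := Subtype.ext h.2
    have hne : i ≠ j := fun h ↦ hij (by rw [h])
    exact disjoint_left.1 (F.disjoint i j hne) (mem_range_self a) ⟨b, h.1⟩
  iUnion_range := by
    ext x
    simp only [mem_iUnion, mem_range]
    constructor
    · rintro ⟨i, a, rfl⟩
      exact sliceMap_mem_ball A i.2.2 (F.incl_mem_ball i.1 a)
    · intro hx
      have h := smul_fst_mem_ball A hx
      rw [← F.iUnion_range] at h
      obtain ⟨i, a, ha⟩ := mem_iUnion.1 h
      refine ⟨(i, ⟨(A x).snd, snd_mem_ball A hx⟩), a, ?_⟩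
      rw [ha]
      exact sliceMap_ballSlicing A hx
  locally_trivial x hx := by
    obtain ⟨φ, hxφ, hφs, hφt, hφ, hφ', hc⟩ := F.locally_trivial _ (smul_fst_mem_ball A hx)
    refine ⟨slicedChart A B φ, (mem_slicedChart_source A B φ).2 ⟨hx, hxφ⟩,
      fun y hy ↦ ((mem_slicedChart_source A B φ).1 hy).1, slicedChart_target A B φ hφs hφt,
      contDiffOn_slicedChart A B φ hφ, contDiffOn_slicedChart_symm A B φ hφs hφt hφ', ?_⟩
    rintro ⟨i, t⟩ a ha
    -- Both charts cut out the same subset of the leaf manifold, hence the same connected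
    -- components.
    have hpre : (fun b : F.Leaf i ↦ sliceMap A t (F.incl i b)) ⁻¹' (slicedChart A B φ).source =
        F.incl i ⁻¹' φ.source := by
      ext b
      rw [mem_preimage, mem_slicedChart_source, ballSlicing_sliceMap A t.2]
      exact and_iff_right (sliceMap_mem_ball A t.2 (F.incl_mem_ball i b))
    rw [hpre] at ha ⊢
    -- Along a leaf the height is fixed, so only the old chart varies and the old plaques give the
    -- new ones.
    have hval : ∀ b : F.Leaf i, slicedChart A B φ (sliceMap A t (F.incl i b)) =
        ((φ (F.incl i b)).1, B ((φ (F.incl i b)).2,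
          OpenPartialHomeomorph.univUnitBall.symm (t : EuclideanSpace ℝ (Fin d)))) := fun b ↦ by
      rw [slicedChart_apply, ballSlicing_sliceMap A t.2, splitting_apply]
    simp only [hval]
    have key := hc i a ha
    ext ⟨z, w⟩
    constructor
    · rintro ⟨b, hb, hbz⟩
      have hb' : φ (F.incl i b) ∈ {z | z.2 = (φ (F.incl i a)).2} := key ▸ mem_image_of_mem _ hb
      rw [Prod.mk.injEq] at hbz
      rw [mem_ofPred_eq, ← hbz.2, hb']
    · intro hw
      have hz : (z, (φ (F.incl i a)).2) ∈ {z | z.2 = (φ (F.incl i a)).2} := rfl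
      rw [← key] at hz
      obtain ⟨b, hb, hbz⟩ := hz
      refine ⟨b, hb, ?_⟩
      have hbz : φ (F.incl i b) = (z, (φ (F.incl i a)).2) := hbz
      have hw : w = _ := hw
      simp only [hbz, hw]

lemma Complete.sliced {F : Foliation p q (Metric.ball (0 : EuclideanSpace ℝ (Fin (p + q))) 1)}
    (hF : F.Complete) : (F.sliced A B).Complete := fun i ↦ by
  have hc : ENNReal.ofReal (sliceRadius (i.2 : EuclideanSpace ℝ (Fin d))) ≠ 0 :=
    (ENNReal.ofReal_pos.2 (sliceRadius_pos i.2.2)).ne'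
  refine (hF i.1).of_inducedEDist_eq hc ENNReal.ofReal_ne_top
    (inducedEDist_of_enorm_mfderiv_eq hc ENNReal.ofReal_ne_top fun a v ↦ ?_)
  refine Eq.trans ?_ (enorm_sliceLinear_apply A i.2.2 _)
  exact congrArg (enorm (E := EuclideanSpace ℝ (Fin (p + q'))))
    (F.mfderiv_sliceMap_comp_incl A i.2 i.1 a v)

lemma Closed.sliced {F : Foliation p q (Metric.ball (0 : EuclideanSpace ℝ (Fin (p + q))) 1)}
    (hF : F.Closed) : (F.sliced A B).Closed := by
  rintro ⟨i, t⟩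
  obtain ⟨K, hK, hKi⟩ := isClosed_induced_iff.1 (hF i)
  have hfst : Continuous fun x ↦ (A x).fst := by fun_prop
  have hsnd : Continuous fun x ↦ (A x).snd := by fun_prop
  -- Freezing the radius at its value for `t` changes nothing on this slice and makes the rescaling
  -- continuous on the whole space.
  have hclosed : IsClosed {x : EuclideanSpace ℝ (Fin (p + q')) | (A x).snd = t ∧
      (sliceRadius (t : EuclideanSpace ℝ (Fin d)))⁻¹ • (A x).fst ∈ K} :=
    (isClosed_eq hsnd continuous_const).inter
      (hK.preimage (hfst.const_smul (sliceRadius (t : EuclideanSpace ℝ (Fin d)))⁻¹))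
  convert hclosed.preimage continuous_subtype_val using 1
  ext ⟨x, hx⟩
  constructor
  · rintro ⟨a, ha⟩
    have ha : sliceMap A t (F.incl i a) = x := ha
    have h : ballSlicing A x = (F.incl i a, (t : EuclideanSpace ℝ (Fin d))) :=
      ha ▸ ballSlicing_sliceMap A t.2 (F.incl i a)
    have h2 : (A x).snd = t := congrArg Prod.snd h
    have h1 : (sliceRadius (A x).snd)⁻¹ • (A x).fst = F.incl i a := congrArg Prod.fst h
    rw [h2] at h1
    refine ⟨h2, ?_⟩
    have hmem : (⟨F.incl i a, F.incl_mem_ball i a⟩ : Metric.ball _ _) ∈ Subtype.val ⁻¹' K := by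
      rw [hKi]
      exact mem_range_self a
    rw [h1]
    exact hmem
  · rintro ⟨h2, h1⟩
    rw [← h2] at h1
    have hmem : (⟨_, smul_fst_mem_ball A hx⟩ : Metric.ball _ _) ∈ Subtype.val ⁻¹' K := h1
    rw [hKi] at hmem
    obtain ⟨a, ha⟩ := hmem
    refine ⟨a, ?_⟩
    change sliceMap A t (F.incl i a) = x
    rw [ha, ← h2]
    exact sliceMap_ballSlicing A hx

lemma HasLeaf.sliced {F : Foliation p q (Metric.ball (0 : EuclideanSpace ℝ (Fin (p + q))) 1)}
    {L : Type*} [TopologicalSpace L] [ChartedSpace (EuclideanSpace ℝ (Fin p)) L]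
    (hF : F.HasLeaf L) : (F.sliced A B).HasLeaf L := by
  obtain ⟨i, hi⟩ := hF
  -- Any height would do; the central slice is chosen.
  exact ⟨(i, ⟨0, Metric.mem_ball_self one_pos⟩), hi⟩

end Foliation

theorem proposition6p1 (p q q' : ℕ) (hq : 1 ≤ q) (hqq' : q < q')
    (L : Type*) [TopologicalSpace L] [ChartedSpace (EuclideanSpace ℝ (Fin p)) L]
    [IsManifold (𝓡 p) ∞ L] [ConnectedSpace L]
    (h : ∃ F : Foliation p q (Metric.ball (0 : EuclideanSpace ℝ (Fin (p + q))) 1),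
      F.Complete ∧ F.Closed ∧ F.HasLeaf L) :
    ∃ F : Foliation p q' (Metric.ball (0 : EuclideanSpace ℝ (Fin (p + q'))) 1),
      F.Complete ∧ F.Closed ∧ F.HasLeaf L := by
  obtain ⟨F, hcomplete, hclosed, hleaf⟩ := h
  have hA : Module.finrank ℝ (WithLp 2 (EuclideanSpace ℝ (Fin (p + q)) ×
      EuclideanSpace ℝ (Fin (q' - q)))) = p + q' := by
    rw [(WithLp.linearEquiv 2 ℝ _).finrank_eq, Module.finrank_prod, finrank_euclideanSpace_fin,
      finrank_euclideanSpace_fin]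
    omega
  -- `A` must be an isometry, to respect the ball and the induced metrics; `B` only relabels
  -- transverse coordinates, so a linear isomorphism suffices.
  let A := ((stdOrthonormalBasis ℝ (WithLp 2 (EuclideanSpace ℝ (Fin (p + q)) ×
    EuclideanSpace ℝ (Fin (q' - q))))).reindex (finCongr hA)).repr.symm
  let B : (EuclideanSpace ℝ (Fin q) × EuclideanSpace ℝ (Fin (q' - q))) ≃L[ℝ]
      EuclideanSpace ℝ (Fin q') := ContinuousLinearEquiv.ofFinrankEq (by
    rw [Module.finrank_prod, finrank_euclideanSpace_fin, finrank_euclideanSpace_fin,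
      finrank_euclideanSpace_fin]
    omega)
  exact ⟨F.sliced A B, hcomplete.sliced A B, hclosed.sliced A B, hleaf.sliced A B⟩
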